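/- **Notation.** Let $\mathcal A=\prod_p(\mathbb Z/p\mathbb Z)\big/\bigoplus_p(\mathbb Z/p\mathbb Z)$ ($p$ over all primes), a $\mathbb Q$-algebra. For $\boldsymbol s=(s_1,\dots,s_d)\in\mathbb Z_{\ge1}^d$ and $\boldsymbol\sigma\in\{\pm1\}^d$ put $$\zeta_{\mathcal A}(\boldsymbol s;\boldsymbol\sigma)=\Big(\sum_{p>n_1>\dots>n_d>0}\prod_{j=1}^d\frac{\sigma_j^{n_j}}{n_j^{s_j}}\bmod p\Big)_p\in\mathcal A ,\qquad \zeta(\boldsymbol s;\boldsymbol\sigma)=\lim_{N\to\infty}\sum_{N>n_1>\dots>n_d>0}\prod_{j=1}^d\frac{\sigma_j^{n_j}}{n_j^{s_j}},$$ the latter for admissible words, i.e. empty words or $(s_1,\sigma_1)\ne(1,1)$. Let $\mathsf{FES}_w\subset\mathcal A$ be the $\mathbb Q$-span of all $\zeta_{\mathcal A}(\boldsymbol s;\boldsymbol\sigma)$ of weight $s_1+\dots+s_d=w$, and $\mathsf{ES}_w\subset\mathbb R$ the $\mathbb Q$-span of all convergent Euler sums $\zeta(\boldsymbol s;\boldsymbol\sigma)$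 of weight $w$ (with $\mathsf{ES}_w=0$ for $w<0$). For $\sharp\in\{\ast,\mathrm{sh}\}$ and $t\in\mathbb R$, let $\zeta_\sharp(\boldsymbol s;\boldsymbol\sigma)\in\mathbb R$ be the $\sharp$-regularized Euler sums: the values of the unique homomorphism, from the stuffle algebra ($\sharp=\ast$) or the shuffle algebra ($\sharp=\mathrm{sh}$) of words to $\mathbb R$, that extends the Euler sums of admissible words and takes the value $t$ on the word $(1;1)$. The symmetric Euler sums are $$\zeta_\sharp^{\mathcal S}(\boldsymbol s;\boldsymbol\sigma)=\sum_{i=0}^d\Big(\prod_{j=1}^i(-1)^{s_j}\sigma_j\Big)\,\zeta_\sharp(s_i,\dots,s_1;\sigma_i,\dots,\sigma_1)\,\zeta_\sharp(s_{i+1},\dots,s_d;\sigma_{i+1},\dots,\sigma_d).$$ For $F\in\{T,S\}$ put $\epsilon_T=1$, $\epsilon_S=0$ and define $$F_{\mathcal A}(\boldsymbol s)=\Big(\sum_{\substack{p>n_1>\dots>n_d>0\\ n_j\equiv d-j+\epsilon_F\,(2)}}\prod_{j=1}^d\frac1{n_j^{s_j}}\bmod p\Big)_p\in\mathcal A,\qquad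 F_\sharp(\boldsymbol s)=\frac1{2^d}\sum_{\boldsymbol\sigma\in\{\pm1\}^d}\Big(\prod_{\substack{1\le j\le d\\ d-j+\epsilon_F\text{ odd}}}\sigma_j\Big)\zeta_\sharp(\boldsymbol s;\boldsymbol\sigma),$$ $$F_\sharp^{\mathcal S}(\boldsymbol s)=\sum_{i=0}^d\Big(\prod_{\ell=1}^i(-1)^{s_\ell}\Big)\,F'_\sharp(s_i,\dots,s_1)\,F_\sharp(s_{i+1},\dots,s_d),$$ where $F'=F$ if $d$ is even, and $\{F,F'\}=\{T,S\}$ if $d$ is odd. **Proposition.** Let $\sharp\in\{\ast,\mathrm{sh}\}$, $t\in\mathbb R$ and $w\ge 0$, and let $$f_{\mathsf{ES}}:\mathsf{FES}_w\longrightarrow \mathsf{ES}_w/\zeta(2)\mathsf{ES}_{w-2}$$ be a $\mathbb Q$-linear map (for instance the isomorphism predicted by the Kaneko–Zagier-type conjecture for Euler sums) that sends $\zeta_{\mathcal A}(\boldsymbol s;\boldsymbol\sigma)$ to the class of $\zeta_\sharp^{\mathcal S}(\boldsymbol s;\boldsymbol\sigma)$ for all $\boldsymbol s,\boldsymbol\sigma$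 of weight $w$. Then, for every $\boldsymbol s=(s_1,\dots,s_d)$ of weight $w$, the values $T_{\mathcal A}(\boldsymbol s)$ and $S_{\mathcal A}(\boldsymbol s)$ lie in $\mathsf{FES}_w$, and $$f_{\mathsf{ES}}\big(T_{\mathcal A}(\boldsymbol s)\big)\equiv T_\sharp^{\mathcal S}(\boldsymbol s),\qquad f_{\mathsf{ES}}\big(S_{\mathcal A}(\boldsymbol s)\big)\equiv S_\sharp^{\mathcal S}(\boldsymbol s)\pmod{\zeta(2)\mathsf{ES}_{w-2}}.$$ -/

import Mathlib

namespace EulerSums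

open Filter

/-! ### Words -/

/-- A letter `(s, σ)` with `s ≥ 1` and `σ = ±1` (the barred integer `s̄` is `(s, -1)`). -/
abbrev Letter : Type := ℕ+ × ℤˣ

/-- A word `(s₁, …, s_d; σ₁, …, σ_d)`, written as the list `[(s₁, σ₁), …, (s_d, σ_d)]`. -/
abbrev Word : Type := List Letter

/-- The weight `s₁ + ⋯ + s_d`. -/
def weight (u : Word) : ℕ := (u.map fun a : Letter => (a.1 : ℕ)).sum

/-- The letter `(1, 1)`. -/
def one : Letter := (1, 1)

/-- A word is admissible if it is empty or if `(s₁, σ₁) ≠ (1, 1)`. -/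
def Admissible (u : Word) : Prop := u.head? ≠ some one

/-- The truncated sum `∑_{N > n₁ > ⋯ > n_d > 0} ∏ⱼ σⱼ ^ nⱼ / nⱼ ^ sⱼ` with values in `R`. -/
def truncEulerSum (R : Type) [CommRing R] [Inv R] : Word → ℕ → R
  | [], _ => 1
  | a :: u, N => ∑ n ∈ Finset.Ico 1 N,
      ((a.2 : ℤ) : R) ^ n * ((n : R) ^ (a.1 : ℕ))⁻¹ * truncEulerSum R u n

/-- The two parity patterns. -/
inductive Kind : Type
  | T
  | S

/-- `T` and `S` are interchanged: this is `S + T - F`. -/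
def Kind.other : Kind → Kind
  | .T => .S
  | .S => .T

/-- The parity offset: the index `nⱼ` is congruent to `d - j + F.offset` modulo `2`. -/
def Kind.offset : Kind → ℕ
  | .T => 1
  | .S => 0

/-- The truncated sum `∑ ∏ⱼ 1 / nⱼ ^ sⱼ` over `N > n₁ > ⋯ > n_d > 0` where
`nⱼ ≡ d - j + 1 (mod 2)` for `F = T` and `nⱼ ≡ d - j (mod 2)` for `F = S`
(for the head of a list with tail `s`, the number `d - j` is the length of `s`). -/
def truncTS (R : Type) [CommRing R] [Inv R] (F : Kind) : List ℕ+ → ℕ → R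
  | [], _ => 1
  | a :: s, N => ∑ n ∈ (Finset.Ico 1 N).filter (fun n => n ≡ s.length + F.offset [MOD 2]),
      ((n : R) ^ (a : ℕ))⁻¹ * truncTS R F s n

/-! ### The ring `𝒜 = ∏ₚ ℤ/p / ⨁ₚ ℤ/p` -/

/-- The ideal `⨁ₚ ℤ/p` of `∏ₚ ℤ/p`. -/
def finSuppIdeal : Ideal (∀ p : Nat.Primes, ZMod p) where
  carrier := {x | {p | x p ≠ 0}.Finite}
  zero_mem' := by simp
  add_mem' := by
    intro x y hx hy
    refine (Set.Finite.union hx hy).subset fun p hp => ?_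
    by_contra h
    simp only [Set.mem_union, Set.mem_ofPred_eq, not_or, not_not] at h
    exact hp (by simp [h.1, h.2])
  smul_mem' := by
    intro c x hx
    refine Set.Finite.subset hx fun p hp h => ?_
    exact hp (by simp [h])

/-- The ring `𝒜`. -/
def AdeleA : Type := (∀ p : Nat.Primes, ZMod p) ⧸ finSuppIdeal

noncomputable instance : CommRing AdeleA :=
  inferInstanceAs (CommRing ((∀ p : Nat.Primes, ZMod p) ⧸ finSuppIdeal))

/-- The class in `𝒜` of a family of residues. -/
def AdeleA.mk (x : ∀ p : Nat.Primes, ZMod p) : AdeleA := Ideal.Quotient.mk finSuppIdeal x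

theorem AdeleA.isUnit_intCast (y : nonZeroDivisors ℤ) :
    IsUnit (Int.castRingHom AdeleA y) := by
  obtain ⟨n, hn⟩ := y
  have hn0 : n ≠ 0 := nonZeroDivisors.ne_zero hn
  refine IsUnit.of_mul_eq_one (AdeleA.mk fun p => ((n : ZMod p))⁻¹) ?_
  have h1 : (Int.castRingHom AdeleA n) = AdeleA.mk fun p => (n : ZMod p) := by
    have h := map_intCast (Ideal.Quotient.mk finSuppIdeal) n
    exact h.symm
  change Int.castRingHom AdeleA n * _ = 1
  rw [h1]
  change Ideal.Quotient.mk finSuppIdeal _ * Ideal.Quotient.mk finSuppIdeal _ =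
    Ideal.Quotient.mk finSuppIdeal 1
  rw [← map_mul, Ideal.Quotient.eq]
  have hfin : {p : Nat.Primes | (p : ℕ) ≤ n.natAbs}.Finite :=
    Set.Finite.preimage (Subtype.val_injective.injOn) (Set.finite_Iic n.natAbs)
  refine Set.Finite.subset hfin fun p hp => ?_
  have : Fact (p : ℕ).Prime := ⟨p.2⟩
  by_contra hlt
  apply hp
  have hne : (n : ZMod p) ≠ 0 := by
    rw [Ne, ZMod.intCast_zmod_eq_zero_iff_dvd]
    intro hd
    have := Nat.le_of_dvd (Int.natAbs_pos.mpr hn0) (Int.natCast_dvd.mp hd)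
    exact hlt this
  simp [mul_inv_cancel₀ hne]

/-- `𝒜` is a `ℚ`-algebra (in exactly one way): every non-zero integer is a unit of `𝒜`. -/
noncomputable instance : Algebra ℚ AdeleA :=
  (IsLocalization.lift (M := nonZeroDivisors ℤ) (S := ℚ) AdeleA.isUnit_intCast).toAlgebra

/-! ### The finite side -/

/-- The finite Euler sum `ζ_𝒜(s; σ)`. -/
noncomputable def finiteEulerSum (u : Word) : AdeleA :=
  AdeleA.mk fun p => truncEulerSum (ZMod p) u p

/-- The finite multiple `T`- and `S`-values `T_𝒜(s)` and `S_𝒜(s)`. -/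
noncomputable def finiteTS (F : Kind) (s : List ℕ+) : AdeleA :=
  AdeleA.mk fun p => truncTS (ZMod p) F s p

/-- The `ℚ`-span of all finite Euler sums of weight `w`. -/
noncomputable def FES (w : ℕ) : Submodule ℚ AdeleA :=
  Submodule.span ℚ {x | ∃ u : Word, weight u = w ∧ x = finiteEulerSum u}

theorem finiteEulerSum_mem {w : ℕ} {u : Word} (h : weight u = w) : finiteEulerSum u ∈ FES w :=
  Submodule.subset_span ⟨u, h, rfl⟩

/-! ### Euler sums -/

/-- The Euler sum `ζ(s; σ)` of an admissible word, as the limit of its truncated sums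
(the series converges only conditionally when `(s₁, σ₁) = (1, -1)`). -/
noncomputable def eulerSum (u : Word) : ℝ :=
  limUnder atTop fun N : ℕ => truncEulerSum ℝ u N

/-- The `ℚ`-span of all (convergent) Euler sums of weight `w`. -/
noncomputable def ES (w : ℕ) : Submodule ℚ ℝ :=
  Submodule.span ℚ {x | ∃ u : Word, Admissible u ∧ weight u = w ∧ x = eulerSum u}

/-- `ζ(2) ES_{w-2}`, which is zero for `w < 2`. -/
noncomputable def zetaTwoES : ℕ → Submodule ℚ ℝ
  | 0 => ⊥
  | 1 => ⊥
  | w + 2 => (ES w).map (LinearMap.mulLeft ℚ (eulerSum [(2, 1)]))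

/-- The quotient `ES_w / ζ(2) ES_{w-2}`. -/
abbrev ESModZetaTwo (w : ℕ) : Type := ES w ⧸ (zetaTwoES w).comap (ES w).subtype

/-- The injection of `ES_w / ζ(2) ES_{w-2}` into `ℝ / ζ(2) ES_{w-2}` induced by the inclusion
of `ES_w` into `ℝ`. -/
noncomputable def inclModZetaTwo (w : ℕ) : ESModZetaTwo w →ₗ[ℚ] ℝ ⧸ zetaTwoES w :=
  Submodule.mapQ _ _ (ES w).subtype le_rfl

theorem inclModZetaTwo_injective (w : ℕ) : Function.Injective (inclModZetaTwo w) := by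
  rw [← LinearMap.ker_eq_bot, inclModZetaTwo, Submodule.ker_mapQ]
  exact Submodule.mkQ_map_self _

/-! ### Regularized Euler sums -/

/-- `(s, σ) ↦ (s + 1, σ)`: the stuffle contraction of a letter with the letter `(1, 1)`. -/
def bump (a : Letter) : Letter := (a.1 + 1, a.2)

/-- `stuffleAux t k u` is the stuffle regularized value of `(1,1)ᵏ u`, where `u` is admissible.
The stuffle product of `y = (1,1)` with `yᵏ u` is
`(k+1) yᵏ⁺¹ u + ∑_{i<k} yⁱ (2,1) yᵏ⁻¹⁻ⁱ u + ∑ yᵏ u' + ∑ yᵏ u''`,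
where `u'` runs through the contractions of `y` with a letter of `u` and `u''` through the
insertions of `y` into `u` behind the first letter of `u`. The regularized value is
multiplicative and sends `y` to `t`, so this product has the value `t` times that of `yᵏ u`. -/
noncomputable def stuffleAux (t : ℝ) : ℕ → Word → ℝ
  | 0, u => eulerSum u
  | k + 1, u =>
      (t * stuffleAux t k u
        - ∑ i : Fin k, stuffleAux t i.val
            (bump one :: (List.replicate (k - 1 - i.val) one ++ u))
        - ∑ i ∈ Finset.range u.length, stuffleAux t k (u.modify i bump)
        - ∑ i ∈ Finset.Icc 1 u.length, stuffleAux t k (u.insertIdx i one)) / (k + 1)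
  termination_by k => k
  decreasing_by all_goals omega

/-- The stuffle regularized Euler sum: the value at `u` of the unique homomorphism from the
stuffle algebra of words to `ℝ` that extends the Euler sums of admissible words and sends
the word `(1,1)` to `t`. -/
noncomputable def stuffleReg (t : ℝ) (u : Word) : ℝ :=
  stuffleAux t (u.takeWhile (· = one)).length (u.dropWhile (· = one))

/-- Letters of the iterated integral words: `none` is `x₀ = dt/t`, and `some η` is
`x_η = η dt/(1 - η t)`. -/
abbrev IntegralWord : Type := List (Option ℤˣ)

/-- `toIntegral 1 (s; σ) = x₀^{s₁-1} x_{η₁} ⋯ x₀^{s_d-1} x_{η_d}` with `ηⱼ = σ₁ ⋯ σⱼ`;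
the first argument is the preceding `η`. -/
def toIntegral : ℤˣ → Word → IntegralWord
  | _, [] => []
  | η, a :: u => List.replicate ((a.1 : ℕ) - 1) none ++ some (η * a.2) :: toIntegral (η * a.2) u

/-- The inverse conversion, `ofIntegral 1 0`, with `σ₁ = η₁` and `σⱼ = ηⱼ / ηⱼ₋₁`; the arguments
are the preceding `η` and the number of letters `x₀` read since. -/
def ofIntegral : ℤˣ → ℕ → IntegralWord → Word
  | _, _, [] => []
  | η, c, none :: v => ofIntegral η (c + 1) v
  | η, c, some θ :: v => (c.succPNat, θ / η) :: ofIntegral θ 0 v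

/-- `shuffleAux t k v` is the shuffle regularized value of `x₁ᵏ v`, where `v` does not begin
with `x₁`. The shuffle product of `x₁` with `x₁ᵏ v` is `(k+1) x₁ᵏ⁺¹ v + ∑ x₁ᵏ v'`, where `v'`
runs through the insertions of `x₁` into `v` behind the first letter of `v`. The regularized
value is multiplicative and sends `x₁` to `t`, so this product has the value `t` times that
of `x₁ᵏ v`. -/
noncomputable def shuffleAux (t : ℝ) : ℕ → IntegralWord → ℝ
  | 0, v => eulerSum (ofIntegral 1 0 v)
  | k + 1, v =>
      (t * shuffleAux t k v
        - ∑ i ∈ Finset.Icc 1 v.length, shuffleAux t k (v.insertIdx i (some 1))) / (k + 1)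

/-- The shuffle regularized Euler sum: the value at `u` of the unique homomorphism from the
shuffle algebra of words to `ℝ` that extends the Euler sums of admissible words and sends
the word `(1,1)` to `t`. -/
noncomputable def shuffleReg (t : ℝ) (u : Word) : ℝ :=
  shuffleAux t ((toIntegral 1 u).takeWhile (· = some 1)).length
    ((toIntegral 1 u).dropWhile (· = some 1))

/-- The two regularizations `♯ = ∗` and `♯ = ⧢`. -/
inductive Regularization : Type
  | stuffle
  | shuffle

/-- The regularized Euler sum `ζ_♯(s; σ)`, normalized by `ζ_♯(1; 1) = t`. -/
noncomputable def regEulerSum (r : Regularization) (t : ℝ) (u : Word) : ℝ :=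
  match r with
  | .stuffle => stuffleReg t u
  | .shuffle => shuffleReg t u

/-! ### The symmetric side -/

/-- The symmetric Euler sum
`ζ_♯^𝒮(s; σ) = ∑_{i=0}^d (∏_{j≤i} (-1)^{sⱼ} σⱼ) ζ_♯(sᵢ, …, s₁; σᵢ, …, σ₁)
  ζ_♯(sᵢ₊₁, …, s_d; σᵢ₊₁, …, σ_d)`. -/
noncomputable def symEulerSum (r : Regularization) (t : ℝ) (u : Word) : ℝ :=
  ∑ i ∈ Finset.range (u.length + 1),
    ((u.take i).map fun a : Letter => (-1 : ℝ) ^ (a.1 : ℕ) * ((a.2 : ℤ) : ℝ)).prod *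
      regEulerSum r t (u.take i).reverse * regEulerSum r t (u.drop i)

/-- The regularized multiple `T`- and `S`-values
`F_♯(s) = 2^{-d} ∑_σ (∏ⱼ σⱼ) ζ_♯(s; σ)`, where the product is over the `j` with `d - j` even if
`F = T` and odd if `F = S` (the `Fin` index `j` below is the index `j + 1` of this formula). -/
noncomputable def regTS (r : Regularization) (t : ℝ) (F : Kind) (s : List ℕ+) : ℝ :=
  1 / 2 ^ s.length * ∑ σ : Fin s.length → ℤˣ,
    (∏ j : Fin s.length with s.length - (j.val + 1) + F.offset ≡ 1 [MOD 2],
      (((σ j : ℤˣ) : ℤ) : ℝ)) *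
      regEulerSum r t (List.ofFn fun j => (s.get j, σ j))

/-- The symmetric multiple `T`- and `S`-values `F_♯^𝒮(s)`. -/
noncomputable def symTS (r : Regularization) (t : ℝ) (F : Kind) (s : List ℕ+) : ℝ :=
  if Even s.length then
    ∑ i ∈ Finset.range (s.length + 1),
      ((s.take i).map fun a : ℕ+ => (-1 : ℝ) ^ (a : ℕ)).prod *
        regTS r t F (s.take i).reverse * regTS r t F (s.drop i)
  else
    ∑ i ∈ Finset.range (s.length + 1),
      ((s.take i).map fun a : ℕ+ => (-1 : ℝ) ^ (a : ℕ)).prod *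
        regTS r t F.other (s.take i).reverse * regTS r t F (s.drop i)

end EulerSums

/-!
Detecting a parity by signs, `∑_{σ = ±1} σ ^ (n + k) = 2` or `0` according as `n ≡ k (mod 2)`
or not, writes `2 ^ d F_𝒜(s)` as the sum of the finite Euler sums `ζ_𝒜(s; σ)` over all
`σ ∈ {±1} ^ d` with the coefficients `∏ⱼ σⱼ ^ (d - j + ε_F)` (`signSum_truncEulerSum`), which are
those in the definition of `2 ^ d F_♯(s)` (`two_pow_mul_regTS`). Hence `F_𝒜(s)` lies in the span of
the finite Euler sums, and by linearity `f` sends it to `2 ^ (-d)` times the sum of the symmetric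
Euler sums `ζ_♯^𝒮(s; σ)` with the same coefficients.

The latter equals `F_♯^𝒮(s)` already as a real number (`signSum_symEulerSum`). In the `i`-th term
of `ζ_♯^𝒮(s; σ)` the sum over `σ` factors into a sum over `σ₁, …, σᵢ` and one over
`σᵢ₊₁, …, σ_d`. The second gives `F_♯(sᵢ₊₁, …, s_d)`. In the first, the factor `σ₁ ⋯ σᵢ` changes
the exponent of `σⱼ` to `d - j + ε_F + 1`, while the reversed word `(sᵢ, …, s₁)` requires
`j - 1 + ε_{F'}`; modulo `2` these agree for all `j` exactly when `ε_{F'} ≡ ε_F + d`, which is the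
rule that defines `F'`. No property of the regularized values enters.
-/

namespace EulerSums

/-! ### Signed sums over words -/

/-- For `l = [(s₁, k₁), …, (s_d, k_d)]`, the sum over all `σ ∈ {±1} ^ d` of
`∏ⱼ σⱼ ^ kⱼ • G (s₁, …, s_d; σ₁, …, σ_d)`. Only the parities of the exponents `kⱼ` matter,
so they are taken in `ℤ/2`. -/
def signSum {M : Type*} [AddCommGroup M] : List (ℕ+ × ZMod 2) → (Word → M) → M
  | [], G => G []
  | (a, k) :: l, G => ∑ ε : ℤˣ, (ε ^ k) • signSum l fun u => G ((a, ε) :: u)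

section signSum

variable {M N : Type*} [AddCommGroup M] [AddCommGroup N]

theorem map_signSum (φ : M →+ N) (l : List (ℕ+ × ZMod 2)) (G : Word → M) :
    φ (signSum l G) = signSum l fun u => φ (G u) := by
  induction l generalizing G with
  | nil => rfl
  | cons x l ih =>
    simp only [signSum, map_sum, Units.smul_def, map_zsmul, ih]

theorem signSum_congr {l : List (ℕ+ × ZMod 2)} {G H : Word → M}
    (h : ∀ u : Word, u.map Prod.fst = l.map Prod.fst → G u = H u) :
    signSum l G = signSum l H := by
  induction l generalizing G H with
  | nil => exact h [] rfl
  | cons x l ih =>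
    refine Finset.sum_congr rfl fun ε _ => ?_
    rw [ih fun u hu => h _ (by simp [hu])]

theorem signSum_sum {ι : Type*} (I : Finset ι) (l : List (ℕ+ × ZMod 2)) (G : ι → Word → M) :
    (signSum l fun u => ∑ i ∈ I, G i u) = ∑ i ∈ I, signSum l (G i) := by
  induction l generalizing G with
  | nil => rfl
  | cons x l ih =>
    simp only [signSum, ih, Finset.smul_sum]
    exact Finset.sum_comm

theorem signSum_zsmul (c : ℤ) (l : List (ℕ+ × ZMod 2)) (G : Word → M) :
    (signSum l fun u => c • G u) = c • signSum l G :=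
  (map_signSum (zsmulAddGroupHom c) l G).symm

theorem signSum_units_smul (c : ℤˣ) (l : List (ℕ+ × ZMod 2)) (G : Word → M) :
    (signSum l fun u => c • G u) = c • signSum l G :=
  signSum_zsmul (c : ℤ) l G

theorem signSum_mul_left {R : Type*} [Ring R] (c : R) (l : List (ℕ+ × ZMod 2)) (G : Word → R) :
    (signSum l fun u => c * G u) = c * signSum l G :=
  (map_signSum (AddMonoidHom.mulLeft c) l G).symm

theorem signSum_mul_right {R : Type*} [Ring R] (c : R) (l : List (ℕ+ × ZMod 2)) (G : Word → R) :
    (signSum l fun u => G u * c) = signSum l G * c :=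
  (map_signSum (AddMonoidHom.mulRight c) l G).symm

theorem signSum_append (l₁ l₂ : List (ℕ+ × ZMod 2)) (G : Word → M) :
    signSum (l₁ ++ l₂) G = signSum l₁ fun u => signSum l₂ fun v => G (u ++ v) := by
  induction l₁ generalizing G with
  | nil => rfl
  | cons x l₁ ih => simp only [List.cons_append, signSum, ih]

theorem signSum_reverse (l : List (ℕ+ × ZMod 2)) (G : Word → M) :
    signSum l.reverse G = signSum l fun u => G u.reverse := by
  induction l generalizing G with
  | nil => rfl
  | cons x l ih =>
    simp only [List.reverse_cons, signSum_append, signSum, signSum_sum, signSum_units_smul, ih]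

/-- Multiplying the summand by `∏ⱼ (-1) ^ sⱼ σⱼ` raises all the exponents by one. -/
theorem signSum_twist (l : List (ℕ+ × ZMod 2)) (G : Word → ℝ) :
    (signSum l fun u =>
        (u.map fun a : Letter => (-1 : ℝ) ^ (a.1 : ℕ) * ((a.2 : ℤ) : ℝ)).prod * G u) =
      (l.map fun x => (-1 : ℝ) ^ (x.1 : ℕ)).prod *
        signSum (l.map fun x => (x.1, x.2 + 1)) G := by
  induction l generalizing G with
  | nil => simp [signSum]
  | cons x l ih =>
    simp only [signSum, List.map_cons, List.prod_cons, Finset.mul_sum]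
    refine Finset.sum_congr rfl fun ε _ => ?_
    simp only [mul_assoc, signSum_mul_left, ih, uzpow_add, uzpow_one, Units.smul_def,
      zsmul_eq_mul, Units.val_mul, Int.cast_mul]
    ring

end signSum

/-! ### The parity pattern of an index -/

/-- The list of the pairs `(sⱼ, d - j + e)`. -/
def withParity (e : ZMod 2) : List ℕ+ → List (ℕ+ × ZMod 2)
  | [] => []
  | a :: s => (a, s.length + e) :: withParity e s

theorem map_fst_withParity (e : ZMod 2) (s : List ℕ+) :
    (withParity e s).map Prod.fst = s := by
  induction s with
  | nil => rfl
  | cons a s ih => simp [withParity, ih]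

theorem withParity_append (e : ZMod 2) (s₁ s₂ : List ℕ+) :
    withParity e (s₁ ++ s₂) = withParity (e + s₂.length) s₁ ++ withParity e s₂ := by
  induction s₁ with
  | nil => rfl
  | cons a s₁ ih =>
    simp only [List.cons_append, withParity, ih, List.length_append]
    push_cast
    rw [add_assoc, add_comm (s₂.length : ZMod 2)]

/-- The exponents `d - j + e + 1` and `j - 1 + e + d` have the same parity. -/
theorem reverse_withParity (e : ZMod 2) (s : List ℕ+) :
    ((withParity e s).map fun x => (x.1, x.2 + 1)).reverse =
      withParity (e + s.length) s.reverse := by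
  induction s with
  | nil => rfl
  | cons a s ih =>
    have h : e + ((s.length : ZMod 2) + 1) + 1 = e + s.length := by
      rw [← add_assoc, add_assoc _ 1 1, CharTwo.add_self_eq_zero, add_zero]
    simp [withParity, withParity_append, ih, h]
    ring

/-! ### Values with parity conditions as signed sums -/

theorem sum_units_pow_mul_pow {R : Type*} [CommRing R] (k n : ℕ) :
    ∑ ε : ℤˣ, (((ε ^ (k : ZMod 2) : ℤˣ) : ℤ) : R) * ((ε : ℤ) : R) ^ n =
      if n ≡ k [MOD 2] then 2 else 0 := by
  have h : ∀ ε : ℤˣ, (((ε ^ (k : ZMod 2) : ℤˣ) : ℤ) : R) * ((ε : ℤ) : R) ^ n =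
      ((ε : ℤ) : R) ^ (k + n) := fun ε => by
    rw [uzpow_natCast, pow_add]; push_cast; rfl
  rw [Finset.sum_congr rfl fun ε _ => h ε, UnitsInt.univ]
  rw [Finset.sum_pair (by decide)]
  split_ifs with hkn
  · have : Even (k + n) := by rw [Nat.ModEq] at hkn; rw [Nat.even_iff]; omega
    simp [this.neg_one_pow, one_add_one_eq_two]
  · have : Odd (k + n) := by rw [Nat.ModEq] at hkn; rw [Nat.odd_iff]; omega
    simp [this.neg_one_pow]

/-- Valid in every ring: the inverses are the same on both sides, and `2` need not be
invertible. -/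
theorem signSum_truncEulerSum (R : Type) [CommRing R] [Inv R] (F : Kind) (s : List ℕ+) (N : ℕ) :
    (signSum (withParity F.offset s) fun u => truncEulerSum R u N) =
      2 ^ s.length * truncTS R F s N := by
  induction s generalizing N with
  | nil => simp [withParity, signSum, truncEulerSum, truncTS]
  | cons a s ih =>
    simp only [withParity, signSum, truncEulerSum, truncTS, signSum_sum, signSum_mul_left, ih,
      Units.smul_def, zsmul_eq_mul, Finset.mul_sum, List.length_cons]
    rw [Finset.sum_comm, Finset.sum_filter]
    refine Finset.sum_congr rfl fun n _ => ?_
    have h := sum_units_pow_mul_pow (R := R) (s.length + F.offset) n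
    simp only [Nat.cast_add] at h
    simp only [← mul_assoc, ← Finset.sum_mul, h]
    split_ifs <;> ring

theorem sum_fin_signs (e : ℕ) (s : List ℕ+) (G : Word → ℝ) :
    ∑ σ : Fin s.length → ℤˣ,
      (∏ j : Fin s.length with s.length - (j.val + 1) + e ≡ 1 [MOD 2],
        (((σ j : ℤˣ) : ℤ) : ℝ)) * G (List.ofFn fun j => (s.get j, σ j)) =
      signSum (withParity e s) G := by
  induction s generalizing G with
  | nil => simp [withParity, signSum]
  | cons a s ih =>
    simp only [withParity, signSum, ← ih]
    change ∑ σ : Fin (s.length + 1) → ℤˣ, _ = _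
    rw [← (Fin.consEquiv fun _ : Fin (s.length + 1) => ℤˣ).sum_comp, Fintype.sum_prod_type]
    refine Finset.sum_congr rfl fun ε _ => ?_
    rw [Finset.smul_sum]
    refine Finset.sum_congr rfl fun σ _ => ?_
    have h : (((ε ^ ((s.length : ZMod 2) + e) : ℤˣ) : ℤ) : ℝ) =
        if s.length + e ≡ 1 [MOD 2] then ((ε : ℤ) : ℝ) else 1 := by
      rw [← Nat.cast_add, uzpow_natCast]
      split_ifs with hp
      · have : Odd (s.length + e) := Nat.odd_iff.2 hp
        rcases Int.units_eq_one_or ε with rfl | rfl <;> simp [this.neg_one_pow]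
      · have : Even (s.length + e) := by rw [Nat.ModEq] at hp; rw [Nat.even_iff]; omega
        rcases Int.units_eq_one_or ε with rfl | rfl <;> simp [this.neg_one_pow]
    rw [Finset.prod_filter, Finset.prod_filter, Units.smul_def, zsmul_eq_mul, h]
    simp [Fin.prod_univ_succ, Fin.consEquiv, List.ofFn_succ, mul_assoc]

theorem two_pow_mul_regTS (r : Regularization) (t : ℝ) (F : Kind) (s : List ℕ+) :
    2 ^ s.length * regTS r t F s = signSum (withParity F.offset s) (regEulerSum r t) := by
  rw [regTS, sum_fin_signs F.offset s, ← mul_assoc, mul_one_div_cancel (by positivity), one_mul]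

/-! ### The symmetric side -/

/-- The pattern written `F'` for an index of depth `d`. -/
def Kind.dual (F : Kind) (d : ℕ) : Kind := if Even d then F else F.other

theorem Kind.offset_dual (F : Kind) (d : ℕ) :
    ((F.dual d).offset : ZMod 2) = F.offset + d := by
  unfold Kind.dual
  split_ifs with h
  · rw [(ZMod.natCast_eq_zero_iff_even).2 h, add_zero]
  · rw [(ZMod.natCast_eq_one_iff_odd).2 (Nat.not_even_iff_odd.1 h)]
    cases F <;> decide

theorem symTS_eq (r : Regularization) (t : ℝ) (F : Kind) (s : List ℕ+) :
    symTS r t F s = ∑ i ∈ Finset.range (s.length + 1),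
      ((s.take i).map fun a : ℕ+ => (-1 : ℝ) ^ (a : ℕ)).prod *
        regTS r t (F.dual s.length) (s.take i).reverse * regTS r t F (s.drop i) := by
  unfold symTS Kind.dual
  split_ifs <;> rfl

/-- The contribution of the splitting of the index into `s₁` and `s₂`. -/
theorem signSum_split (r : Regularization) (t : ℝ) (F : Kind) (s₁ s₂ : List ℕ+) :
    (signSum (withParity F.offset (s₁ ++ s₂)) fun u =>
      ((u.take s₁.length).map fun a : Letter => (-1 : ℝ) ^ (a.1 : ℕ) * ((a.2 : ℤ) : ℝ)).prod *
        regEulerSum r t (u.take s₁.length).reverse * regEulerSum r t (u.drop s₁.length)) =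
      2 ^ (s₁ ++ s₂).length * ((s₁.map fun a : ℕ+ => (-1 : ℝ) ^ (a : ℕ)).prod *
        regTS r t (F.dual (s₁ ++ s₂).length) s₁.reverse * regTS r t F s₂) := by
  have hd : ((F.dual (s₁ ++ s₂).length).offset : ZMod 2) = F.offset + s₂.length + s₁.length := by
    rw [Kind.offset_dual, List.length_append]; push_cast; ring
  have h₁ := two_pow_mul_regTS r t (F.dual (s₁ ++ s₂).length) s₁.reverse
  have h₂ := two_pow_mul_regTS r t F s₂
  rw [hd, ← reverse_withParity, signSum_reverse, List.length_reverse] at h₁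
  have hs : ((withParity (F.offset + s₂.length) s₁).map fun x => (-1 : ℝ) ^ (x.1 : ℕ)) =
      s₁.map fun a : ℕ+ => (-1 : ℝ) ^ (a : ℕ) := by
    conv_rhs => rw [← map_fst_withParity (F.offset + s₂.length) s₁]
    rw [List.map_map]; rfl
  rw [withParity_append, signSum_append]
  trans signSum (withParity (F.offset + s₂.length) s₁) fun u =>
    (u.map fun a : Letter => (-1 : ℝ) ^ (a.1 : ℕ) * ((a.2 : ℤ) : ℝ)).prod *
      regEulerSum r t u.reverse * signSum (withParity F.offset s₂) (regEulerSum r t)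
  · refine signSum_congr fun u hu => ?_
    have hl : u.length = s₁.length := by
      rw [map_fst_withParity] at hu
      rw [← hu, List.length_map]
    simp only [← hl, List.take_left', List.drop_left', signSum_mul_left]
  · rw [signSum_mul_right, signSum_twist, hs, ← h₁, ← h₂, List.length_append]
    ring

theorem signSum_symEulerSum (r : Regularization) (t : ℝ) (F : Kind) (s : List ℕ+) :
    signSum (withParity F.offset s) (symEulerSum r t) = 2 ^ s.length * symTS r t F s := by
  trans signSum (withParity F.offset s) fun u => ∑ i ∈ Finset.range (s.length + 1),
    ((u.take i).map fun a : Letter => (-1 : ℝ) ^ (a.1 : ℕ) * ((a.2 : ℤ) : ℝ)).prod *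
      regEulerSum r t (u.take i).reverse * regEulerSum r t (u.drop i)
  · refine signSum_congr fun u hu => ?_
    have hl : u.length = s.length := by
      rw [map_fst_withParity] at hu
      rw [← hu, List.length_map]
    rw [symEulerSum, hl]
  · rw [signSum_sum, symTS_eq, Finset.mul_sum]
    refine Finset.sum_congr rfl fun i hi => ?_
    have hi : (s.take i).length = i :=
      List.length_take_of_le (Nat.lt_succ_iff.1 (Finset.mem_range.1 hi))
    have h := signSum_split r t F (s.take i) (s.drop i)
    rwa [List.take_append_drop, hi] at h

/-! ### The finite side -/

theorem signSum_finiteEulerSum (F : Kind) (s : List ℕ+) :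
    signSum (withParity F.offset s) finiteEulerSum = (2 : ℚ) ^ s.length • finiteTS F s := by
  let q : (∀ p : Nat.Primes, ZMod p) →+* AdeleA := Ideal.Quotient.mk finSuppIdeal
  have h : (signSum (withParity F.offset s) fun u => fun p : Nat.Primes =>
      truncEulerSum (ZMod p) u p) = 2 ^ s.length * fun p : Nat.Primes => truncTS (ZMod p) F s p := by
    funext p
    have := map_signSum (Pi.evalAddMonoidHom (fun p : Nat.Primes => ZMod p) p)
      (withParity F.offset s) fun u => fun p : Nat.Primes => truncEulerSum (ZMod p) u p
    exact this.trans (signSum_truncEulerSum (ZMod p) F s p)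
  have h' := congrArg q h
  rw [map_mul, map_pow, map_ofNat] at h'
  rw [Algebra.smul_def, map_pow, map_ofNat]
  exact (map_signSum q.toAddMonoidHom _ _).symm.trans h'

theorem weight_of_map_fst {u : Word} {s : List ℕ+} (h : u.map Prod.fst = s) :
    weight u = (s.map PNat.val).sum := by
  rw [weight, ← h, List.map_map]; rfl

theorem signSum_mem {M : Type*} [AddCommGroup M] [Module ℚ M] (K : Submodule ℚ M)
    {l : List (ℕ+ × ZMod 2)} {G : Word → M}
    (h : ∀ u : Word, u.map Prod.fst = l.map Prod.fst → G u ∈ K) : signSum l G ∈ K := by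
  induction l generalizing G with
  | nil => exact h [] rfl
  | cons x l ih =>
    refine K.sum_mem fun ε _ => ?_
    rw [Units.smul_def]
    exact K.toAddSubgroup.zsmul_mem (ih fun u hu => h _ (by simp [hu])) _

theorem finiteTS_mem_and_map_eq (r : Regularization) (t : ℝ) (w : ℕ)
    (f : FES w →ₗ[ℚ] ESModZetaTwo w)
    (hf : ∀ (u : Word) (hu : weight u = w),
      inclModZetaTwo w (f ⟨finiteEulerSum u, finiteEulerSum_mem hu⟩) =
        Submodule.Quotient.mk (symEulerSum r t u))
    (F : Kind) (s : List ℕ+) (hs : (s.map PNat.val).sum = w) :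
    ∃ h : finiteTS F s ∈ FES w,
      inclModZetaTwo w (f ⟨finiteTS F s, h⟩) = Submodule.Quotient.mk (symTS r t F s) := by
  -- The graph of `f`, as a submodule of `𝒜 × ℝ / ζ(2) ES_{w-2}`.
  let K : Submodule ℚ (AdeleA × (ℝ ⧸ zetaTwoES w)) :=
    LinearMap.range ((FES w).subtype.prod (inclModZetaTwo w ∘ₗ f))
  have hK : (signSum (withParity F.offset s) fun u =>
      (finiteEulerSum u, (zetaTwoES w).mkQ (symEulerSum r t u))) ∈ K := by
    refine signSum_mem K fun u hu => ?_
    have hw : weight u = w :=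
      (weight_of_map_fst (hu.trans (map_fst_withParity _ s))).trans hs
    exact ⟨⟨finiteEulerSum u, finiteEulerSum_mem hw⟩, Prod.ext rfl (hf u hw)⟩
  have hsum : (signSum (withParity F.offset s) fun u =>
      (finiteEulerSum u, (zetaTwoES w).mkQ (symEulerSum r t u))) =
      (2 : ℚ) ^ s.length • (finiteTS F s, (zetaTwoES w).mkQ (symTS r t F s)) := by
    refine Prod.ext ?_ ?_
    · exact (map_signSum (LinearMap.fst ℚ AdeleA (ℝ ⧸ zetaTwoES w)).toAddMonoidHom _ _).trans (signSum_finiteEulerSum F s)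
    · refine (map_signSum (LinearMap.snd ℚ AdeleA (ℝ ⧸ zetaTwoES w)).toAddMonoidHom _ _).trans ?_
      refine (map_signSum (zetaTwoES w).mkQ.toAddMonoidHom _ _).symm.trans ?_
      rw [signSum_symEulerSum]
      change (zetaTwoES w).mkQ _ = (2 : ℚ) ^ s.length • (zetaTwoES w).mkQ _
      rw [← map_smul, Algebra.smul_def, map_pow, map_ofNat]
  rw [hsum, K.smul_mem_iff (pow_ne_zero _ two_ne_zero)] at hK
  obtain ⟨⟨x, hx⟩, h⟩ := hK
  obtain ⟨rfl, h₂⟩ := Prod.ext_iff.1 h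
  exact ⟨hx, h₂⟩

end EulerSums

open EulerSums in
theorem mainTheorem11 (r : Regularization) (t : ℝ) (w : ℕ)
    (f : FES w →ₗ[ℚ] ESModZetaTwo w)
    (hf : ∀ (u : Word) (hu : weight u = w),
      inclModZetaTwo w (f ⟨finiteEulerSum u, finiteEulerSum_mem hu⟩) =
        Submodule.Quotient.mk (symEulerSum r t u))
    (s : List ℕ+) (hs : (s.map PNat.val).sum = w) :
    (∃ hT : finiteTS Kind.T s ∈ FES w,
      inclModZetaTwo w (f ⟨finiteTS Kind.T s, hT⟩) =
        Submodule.Quotient.mk (symTS r t Kind.T s)) ∧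
    (∃ hS : finiteTS Kind.S s ∈ FES w,
      inclModZetaTwo w (f ⟨finiteTS Kind.S s, hS⟩) =
        Submodule.Quotient.mk (symTS r t Kind.S s)) :=
  ⟨finiteTS_mem_and_map_eq r t w f hf Kind.T s hs, finiteTS_mem_and_map_eq r t w f hf Kind.S s hs⟩
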